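/- Let $P=\{(\xi,\eta)\in\mathbb R^2\mid \xi\ge 0,\ \eta\ge 0\}\setminus\{(0,0)\}$, let $\Phi^t(\xi,\eta)=(e^t\xi,e^{-t}\eta)$ be the standard Reeb flow on $P$, and call a continuous flow $\{\phi^t\}_{t\in\mathbb R}$ on $P$ an $\mathcal R$-flow if it has the same orbits, with the same orientation, as $\{\Phi^t\}$. Two flows $\{\phi^t\},\{\psi^t\}$ on $P$ are topologically conjugate if there is a homeomorphism $h$ of $P$ with $h\circ\phi^t=\psi^t\circ h$ for all $t\in\mathbb R$. Let $E$ be the set of continuous functions $f:(0,\infty)\to\mathbb R$ with $\lim_{x\to0}f(x)=\infty$, and for $f\in E$ put $$\sigma(f)=\limsup_{x\to0}\Bigl(\max_{[x,1]}f-f(x)\Bigr)\in[0,\infty].$$ The function $f(x)=\frac1x\,2^{\sin(2\pi\log_2x)}$ belongs to $E$ and satisfies $f(x/2)=2f(x)$ for all $x>0$ and $\sigma(f)=\infty$. Moreover there is an $\mathcal R$-flow $\{\phi^t\}$ such that: 1. there are continuous paths $\gamma_1,\gamma_2:[0,\infty)\to P$ with $\gamma_1(0)\in\{\xi=0\}$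 and $\gamma_2(0)\in\{\eta=0\}$, each lying in $\{\xi>0,\eta>0\}$ for positive parameters and meeting every orbit in $\{\xi>0,\eta>0\}$ exactly once, such that for every $x>0$ the number $f(x)$ is the unique time $t\in\mathbb R$ with $\phi^t(\gamma_1(x))\in\gamma_2([0,\infty))$; 2. $\{\phi^t\}$ is not topologically conjugate to the standard Reeb flow $\{\Phi^t\}$; 3. $\{\phi^{2t}\}$ is topologically conjugate to $\{\phi^t\}$. In particular, conjugacy of $\{\phi^{\lambda t}\}$ to $\{\phi^t\}$ for the single value $\lambda=2$ does not imply that $\{\phi^t\}$ is conjugate to the standard Reeb flow. -/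

import Mathlib

open Filter Topology Set
open scoped NNReal

/-- The closed quarter plane without its corner,
`P = {(ξ, η) | ξ ≥ 0, η ≥ 0} - {(0, 0)}`, with the subspace topology. -/
abbrev ReebPlane : Type :=
  {p : ℝ × ℝ // 0 ≤ p.1 ∧ 0 ≤ p.2 ∧ p ≠ (0, 0)}

namespace ReebPlane

/-- The boundary leaf `{ξ = 0}`. -/
def xiZero : Set ReebPlane := {p | p.1.1 = 0}

/-- The boundary leaf `{η = 0}`. -/
def etaZero : Set ReebPlane := {p | p.1.2 = 0}

/-- The union of the interior leaves, `{ξ > 0, η > 0}`. -/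
def inner : Set ReebPlane := {p | 0 < p.1.1 ∧ 0 < p.1.2}

end ReebPlane

/-- The standard Reeb flow `Φ^t (ξ, η) = (e^t ξ, e^{-t} η)` on `P`. -/
noncomputable def standardReebFlow : Flow ℝ ReebPlane where
  toFun t p := ⟨(Real.exp t * p.1.1, Real.exp (-t) * p.1.2), by
    obtain ⟨⟨a, b⟩, ha, hb, hab⟩ := p
    refine ⟨mul_nonneg (Real.exp_pos _).le ha, mul_nonneg (Real.exp_pos _).le hb, ?_⟩
    intro h
    apply hab
    simpa [Prod.ext_iff, Real.exp_ne_zero] using h⟩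
  cont' := by
    unfold Function.uncurry
    fun_prop
  map_add' t₁ t₂ p := by
    apply Subtype.ext
    simp only [Prod.mk.injEq, neg_add, Real.exp_add]
    constructor <;> ring
  map_zero' p := by
    apply Subtype.ext
    simp

/-- An `ℛ`-flow: a continuous flow on `P` whose oriented orbit foliation is the Reeb foliation, that
is, which has the same orbits as the standard Reeb flow, run through in the same direction. -/
structure IsReebFlow (φ : Flow ℝ ReebPlane) : Prop where
  orbit_eq : ∀ p, φ.orbit p = standardReebFlow.orbit p
  oriented : ∀ p t, 0 < t → ∃ s, 0 < s ∧ φ t p = standardReebFlow s p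

/-- The flow `{φ^{c t}}` obtained from `{φ^t}` by multiplying time by the constant `c`. -/
def Flow.rescale {X : Type*} [TopologicalSpace X] (φ : Flow ℝ X) (c : ℝ) : Flow ℝ X where
  toFun t x := φ (c * t) x
  cont' := by
    unfold Function.uncurry
    fun_prop
  map_add' t₁ t₂ x := by rw [mul_add, φ.map_add]
  map_zero' x := by rw [mul_zero, φ.map_zero_apply]

/-- Topological conjugacy of flows: a homeomorphism `h` with `h ∘ φ^t = ψ^t ∘ h` for all `t`. -/
def Flow.IsConjugate {X Y : Type*} [TopologicalSpace X] [TopologicalSpace Y]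
    (φ : Flow ℝ X) (ψ : Flow ℝ Y) : Prop :=
  ∃ h : X ≃ₜ Y, Flow.IsSemiconjugacy h φ ψ

/-- A continuous path `γ : [0, ∞) → P` that starts at a point of `B`, lies in the interior of `P`
for positive parameters, and meets every interior leaf exactly once. -/
structure IsReebTransversal (B : Set ReebPlane) (γ : ℝ≥0 → ReebPlane) : Prop where
  continuous : Continuous γ
  start : γ 0 ∈ B
  mem_inner : ∀ x, 0 < x → γ x ∈ ReebPlane.inner
  meets : ∀ p ∈ ReebPlane.inner, ∃! x, γ x ∈ standardReebFlow.orbit p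

/-- `f` is, on `(0, ∞)`, the function `f_{φ, γ₁, γ₂}`: for `x > 0`, the number `f x` is the time
(the only one) that the flow `φ` needs to move from `γ₁ x` to a point of the curve `γ₂`. -/
def IsTransitTime (φ : Flow ℝ ReebPlane) (γ₁ γ₂ : ℝ≥0 → ReebPlane) (f : ℝ → ℝ) : Prop :=
  ∀ x : ℝ≥0, 0 < x → ∀ t : ℝ, φ t (γ₁ x) ∈ range γ₂ ↔ t = f x

/-- The space `E` of continuous functions on `(0, ∞)` that tend to `∞` at `0`. Only the
restriction of `f` to `(0, ∞)` matters. -/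
def reebE : Set (ℝ → ℝ) :=
  {f | ContinuousOn f (Ioi 0) ∧ Tendsto f (𝓝[>] 0) atTop}

/-- `f^*(x) = max (f |_[x, 1]) - f x`, for `0 < x ≤ 1`. -/
noncomputable def reebStar (f : ℝ → ℝ) (x : ℝ) : ℝ :=
  sSup (f '' Icc x 1) - f x

/-- `σ(f) = limsup_{x → 0} f^*(x)`, the upper limit being taken in the extended reals, over `x > 0`. -/
noncomputable def reebSigma (f : ℝ → ℝ) : EReal :=
  limsup (fun x : ℝ => (reebStar f x : EReal)) (𝓝[>] 0)

/-- The function `f(x) = x⁻¹ 2^{sin (2π log₂ x)}`. -/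
noncomputable def reebExample (x : ℝ) : ℝ :=
  x⁻¹ * (2 : ℝ) ^ Real.sin (2 * Real.pi * Real.logb 2 x)

/-! Write `f` for `reebExample` and `x = ξη` for the leaf parameter. From `(x, 1)` to `(1, x)` the
standard flow takes time `-log x`. Slowing it by the factor `1 + 4 K(x) / (ξ² + η²)²`, with `K ≥ 0`
continuous, adds the total delay `K(x) / x²` along the leaf. The choice `K(x) = x² (f(x) + log x)`
therefore gives transit time `f`. It is continuous up to `x = 0` because `f ≤ 2/x`, and nonnegative
because `f ≥ 1/(2x)`.

The new flow has two time coordinates, `leftTime` off `{η = 0}` and `rightTime` off `{ξ = 0}`. Each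
grows at unit rate along the flow, and they differ by the transit time on the common domain.
Doubling the leaf parameter and halving both times respects this gluing exactly when `f(2x) =
f(x)/2`, so it gives the conjugacy for the factor 2 (`isConjugate_rescale_delayFlow`).

A conjugacy to the standard flow would carry the transversals to curves `u`, `v` with `log leaf(u x)
= g(x) - f(x)`, where `g` is continuous at 0. Since `leaf ∘ u` is injective and vanishes at 0, it
would be increasing. This forbids large increases of `f` near 0, but `f` has arbitrarily large ones
(`exists_reebExample_add_lt`). -/

/-! ### Time changes of flows by cocycles. -/

/-- A continuous additive cocycle over a flow that grows at least as fast as time. -/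
structure IsTimeCocycle {X : Type*} [TopologicalSpace X] (Φ : Flow ℝ X) (c : X → ℝ → ℝ) :
    Prop where
  continuous : Continuous (Function.uncurry c)
  add : ∀ p s t, c p (s + t) = c p s + c (Φ s p) t
  le : ∀ p s, 0 ≤ s → s ≤ c p s

namespace IsTimeCocycle

variable {X : Type*} [TopologicalSpace X] {Φ : Flow ℝ X} {c : X → ℝ → ℝ}

theorem sub_le (h : IsTimeCocycle Φ c) (p : X) {s t : ℝ} (hst : s ≤ t) :
    t - s ≤ c p t - c p s := by
  have h1 := h.add p s (t - s)
  have h2 := h.le (Φ s p) (t - s) (by linarith)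
  rw [add_sub_cancel] at h1
  linarith

theorem zero (h : IsTimeCocycle Φ c) (p : X) : c p 0 = 0 := by
  have := h.add p 0 0
  simpa using this

theorem strictMono (h : IsTimeCocycle Φ c) (p : X) : StrictMono (c p) := fun s t hst => by
  have := h.sub_le p hst.le
  linarith

theorem continuous_apply (h : IsTimeCocycle Φ c) (p : X) : Continuous (c p) :=
  h.continuous.comp (Continuous.prodMk_right p)

theorem surjective (h : IsTimeCocycle Φ c) (p : X) : Function.Surjective (c p) := by
  refine (h.continuous_apply p).surjective ?_ ?_
  · refine tendsto_atTop_mono' _ ?_ tendsto_id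
    filter_upwards [eventually_ge_atTop 0] with s hs using h.le p s hs
  · refine tendsto_atBot_mono' _ ?_ tendsto_id
    filter_upwards [eventually_le_atBot 0] with s hs
    have := h.sub_le p hs
    rw [h.zero] at this
    simpa using this

/-- The time of the original flow at which the cocycle reaches a given value. -/
noncomputable def inv (h : IsTimeCocycle Φ c) (p : X) (t : ℝ) : ℝ :=
  (h.surjective p t).choose

theorem apply_inv (h : IsTimeCocycle Φ c) (p : X) (t : ℝ) : c p (h.inv p t) = t :=
  (h.surjective p t).choose_spec

theorem inv_apply (h : IsTimeCocycle Φ c) (p : X) (s : ℝ) : h.inv p (c p s) = s :=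
  (h.strictMono p).injective (h.apply_inv p _)

theorem inv_eq (h : IsTimeCocycle Φ c) {p : X} {s t : ℝ} (hs : c p s = t) : h.inv p t = s := by
  rw [← hs, h.inv_apply]

/-- By monotonicity in time, comparing the inverse with a fixed `a` amounts to comparing `c p a`
with `t`, an open condition in `(p, t)`. -/
theorem continuous_inv (h : IsTimeCocycle Φ c) :
    Continuous (fun q : X × ℝ => h.inv q.1 q.2) := by
  rw [continuous_iff_continuousAt]
  rintro ⟨p, t⟩
  have hcont (s : ℝ) : Continuous fun q : X × ℝ => c q.1 s :=
    h.continuous.comp (continuous_fst.prodMk continuous_const)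
  refine tendsto_order.2 ⟨fun a ha => ?_, fun a ha => ?_⟩
  · have h1 : c p a < t := by
      rw [← h.apply_inv p t]
      exact h.strictMono p ha
    filter_upwards [(isOpen_lt (hcont a) continuous_snd).mem_nhds (x := (p, t)) h1] with q hq
    rw [← (h.strictMono q.1).lt_iff_lt, h.apply_inv]
    exact hq
  · have h1 : t < c p a := by
      nth_rewrite 1 [← h.apply_inv p t]
      exact h.strictMono p ha
    filter_upwards [(isOpen_lt continuous_snd (hcont a)).mem_nhds (x := (p, t)) h1] with q hq
    rw [← (h.strictMono q.1).lt_iff_lt, h.apply_inv]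
    exact hq

/-- The flow obtained from `Φ` by measuring time with a cocycle. -/
noncomputable def timeChange (h : IsTimeCocycle Φ c) : Flow ℝ X where
  toFun t p := Φ (h.inv p t) p
  cont' := by
    refine Φ.continuous ?_ continuous_snd
    exact h.continuous_inv.comp continuous_swap
  map_add' t₁ t₂ p := by
    rw [← Φ.map_add]
    congr 1
    apply h.inv_eq
    rw [add_comm, h.add, h.apply_inv, h.apply_inv, add_comm]
  map_zero' p := by
    rw [h.inv_eq (h.zero p), Φ.map_zero_apply]

theorem timeChange_eq (h : IsTimeCocycle Φ c) (p : X) (t : ℝ) :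
    h.timeChange t p = Φ (h.inv p t) p := rfl

theorem timeChange_apply (h : IsTimeCocycle Φ c) (p : X) (s : ℝ) :
    h.timeChange (c p s) p = Φ s p := by
  rw [timeChange_eq, h.inv_apply]

theorem orbit_timeChange (h : IsTimeCocycle Φ c) (p : X) :
    h.timeChange.orbit p = Φ.orbit p := by
  ext q
  simp only [Flow.mem_orbit_iff]
  constructor
  · rintro ⟨t, rfl⟩
    exact ⟨_, rfl⟩
  · rintro ⟨s, rfl⟩
    exact ⟨c p s, h.timeChange_apply p s⟩

theorem inv_pos (h : IsTimeCocycle Φ c) (p : X) {t : ℝ} (ht : 0 < t) : 0 < h.inv p t := by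
  rw [← (h.strictMono p).lt_iff_lt, h.apply_inv, h.zero]
  exact ht

end IsTimeCocycle

theorem IsTimeCocycle.isReebFlow_timeChange {c : ReebPlane → ℝ → ℝ}
    (h : IsTimeCocycle standardReebFlow c) : IsReebFlow h.timeChange where
  orbit_eq := h.orbit_timeChange
  oriented p _ ht := ⟨_, h.inv_pos p ht, rfl⟩

/-! ### The function `reebExample`. -/

theorem reebExample_one : reebExample 1 = 1 := by simp [reebExample]

theorem reebExample_half {x : ℝ} (hx : 0 < x) : reebExample (x / 2) = 2 * reebExample x := by
  have h1 : Real.logb 2 (x / 2) = Real.logb 2 x - 1 := by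
    rw [Real.logb_div hx.ne' two_ne_zero, Real.logb_self_eq_one one_lt_two]
  simp only [reebExample, h1, mul_sub, mul_one, Real.sin_sub_two_pi]
  field_simp

theorem reebExample_div_two_pow {x : ℝ} (hx : 0 < x) (n : ℕ) :
    reebExample (x / 2 ^ n) = 2 ^ n * reebExample x := by
  induction n with
  | zero => simp
  | succ n ih =>
    rw [pow_succ, ← div_div, reebExample_half (by positivity), ih]
    ring

theorem reebExample_quarter : reebExample ((2 : ℝ) ^ (1 / 4 : ℝ)) = 2 ^ (3 / 4 : ℝ) := by
  rw [reebExample, Real.logb_rpow two_pos (by norm_num),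
    show 2 * Real.pi * (1 / 4) = Real.pi / 2 by ring, Real.sin_pi_div_two,
    ← Real.rpow_neg two_pos.le, ← Real.rpow_add two_pos]
  norm_num

/-- On arbitrarily small intervals the function increases by arbitrarily large amounts. -/
theorem exists_reebExample_add_lt (C : ℝ) {δ : ℝ} (hδ : 0 < δ) :
    ∃ x y, 0 < x ∧ x < y ∧ y < δ ∧ reebExample x + C < reebExample y := by
  -- The sine peaks at `b`, so the function rises from 1 at 1 to `2 ^ (3/4)` at `b`. Dividing the
  -- arguments by `2 ^ n` multiplies this gain by `2 ^ n`.
  set b : ℝ := (2 : ℝ) ^ (1 / 4 : ℝ) with hb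
  have hb1 : 1 < b := Real.one_lt_rpow one_lt_two (by norm_num)
  have h3 : (1 : ℝ) < 2 ^ (3 / 4 : ℝ) := Real.one_lt_rpow one_lt_two (by norm_num)
  have hlim := tendsto_pow_atTop_atTop_of_one_lt (one_lt_two (α := ℝ))
  obtain ⟨n, hn1, hn2⟩ := ((hlim.eventually_gt_atTop (b / δ)).and
    (hlim.eventually_gt_atTop (C / (2 ^ (3 / 4 : ℝ) - 1)))).exists
  have hp : (0 : ℝ) < 2 ^ n := by positivity
  refine ⟨1 / 2 ^ n, b / 2 ^ n, by positivity, by gcongr, ?_, ?_⟩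
  · rw [div_lt_iff₀ hδ] at hn1
    rw [div_lt_iff₀ hp]
    linarith
  · rw [reebExample_div_two_pow one_pos, reebExample_div_two_pow (by positivity), reebExample_one,
      reebExample_quarter]
    rw [div_lt_iff₀ (by linarith)] at hn2
    linarith

theorem continuousOn_reebExample : ContinuousOn reebExample (Ioi 0) := by
  have hlog : ContinuousOn (fun x : ℝ => Real.logb 2 x) (Ioi 0) :=
    (Real.continuousOn_log.mono fun x hx => ne_of_gt hx).div_const _
  have h0 : ContinuousOn (fun x : ℝ => x⁻¹) (Ioi 0) :=
    continuousOn_inv₀.mono fun x hx => ne_of_gt hx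
  refine h0.mul (ContinuousOn.rpow continuousOn_const ?_ fun _ _ => Or.inl two_ne_zero)
  exact Real.continuous_sin.comp_continuousOn (continuousOn_const.mul hlog)

theorem two_rpow_sin_mem (y : ℝ) : (2 : ℝ) ^ Real.sin y ∈ Icc (1 / 2 : ℝ) 2 := by
  constructor
  · calc (1 / 2 : ℝ) = 2 ^ (-1 : ℝ) := by rw [Real.rpow_neg_one]; norm_num
      _ ≤ _ := Real.rpow_le_rpow_of_exponent_le one_le_two (Real.neg_one_le_sin y)
  · calc (2 : ℝ) ^ Real.sin y ≤ 2 ^ (1 : ℝ) :=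
        Real.rpow_le_rpow_of_exponent_le one_le_two (Real.sin_le_one y)
      _ = 2 := Real.rpow_one 2

theorem reebExample_mem_reebE : reebExample ∈ reebE := by
  refine ⟨continuousOn_reebExample, ?_⟩
  have h := (tendsto_inv_nhdsGT_zero (𝕜 := ℝ)).atTop_mul_const (r := 1 / 2) (by norm_num)
  refine tendsto_atTop_mono' _ ?_ h
  filter_upwards [self_mem_nhdsWithin] with x hx
  exact mul_le_mul_of_nonneg_left (two_rpow_sin_mem _).1 (inv_nonneg.2 (le_of_lt hx))

theorem reebSigma_reebExample : reebSigma reebExample = ⊤ := by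
  have key (C : ℝ) : (C : EReal) ≤ reebSigma reebExample := by
    refine le_limsup_of_frequently_le' ?_
    rw [(nhdsGT_basis (0 : ℝ)).frequently_iff]
    intro δ hδ
    -- The bound 1 places `y` in `[x, 1]`, so its value counts in the supremum.
    obtain ⟨x, y, hx, hxy, hy, h⟩ := exists_reebExample_add_lt C (lt_min hδ one_pos)
    refine ⟨x, ⟨hx, hxy.trans (hy.trans_le (min_le_left _ _))⟩, ?_⟩
    rw [EReal.coe_le_coe_iff]
    have hb : BddAbove (reebExample '' Icc x 1) :=
      (isCompact_Icc.image_of_continuousOn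
        (continuousOn_reebExample.mono fun z hz => hx.trans_le hz.1)).bddAbove
    have := le_csSup hb (mem_image_of_mem _ ⟨hxy.le, hy.le.trans (min_le_right _ _)⟩)
    rw [reebStar]
    linarith
  rw [EReal.eq_top_iff_forall_lt]
  intro y
  exact lt_of_lt_of_le (EReal.coe_lt_coe_iff.2 (lt_add_one y)) (key (y + 1))

/-- Applying `log y ≤ y - 1` at `y = 1/(2x)` leaves the margin `1 - log 2 > 0`. This makes the
required delay nonnegative. -/
theorem reebExample_add_log_nonneg {x : ℝ} (hx : 0 < x) : 0 ≤ reebExample x + Real.log x := by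
  have h1 : x⁻¹ * (1 / 2) ≤ reebExample x :=
    mul_le_mul_of_nonneg_left (two_rpow_sin_mem _).1 (inv_nonneg.2 hx.le)
  have h3 := Real.log_le_sub_one_of_pos (show 0 < x⁻¹ / 2 by positivity)
  rw [Real.log_div (inv_ne_zero hx.ne') two_ne_zero, Real.log_inv] at h3
  have := Real.log_two_lt_d9
  linarith

theorem continuous_sq_mul_reebExample_add_log :
    Continuous fun x : ℝ≥0 => (x : ℝ) ^ 2 * (reebExample x + Real.log x) := by
  have h1 : Continuous fun x : ℝ≥0 => (x : ℝ) ^ 2 * reebExample x := by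
    rw [continuous_iff_continuousAt]
    intro x
    rcases eq_or_ne x 0 with rfl | hx
    · have : Tendsto (fun x : ℝ≥0 => (x : ℝ) * 2) (𝓝 0) (𝓝 0) := by
        have : Continuous fun x : ℝ≥0 => (x : ℝ) * 2 := by fun_prop
        simpa using this.tendsto 0
      rw [ContinuousAt, show ((0 : ℝ≥0) : ℝ) ^ 2 * reebExample ((0 : ℝ≥0) : ℝ) = 0 by simp]
      refine squeeze_zero' (Eventually.of_forall fun x => ?_) (Eventually.of_forall fun x => ?_)
        this
      · have := (two_rpow_sin_mem (2 * Real.pi * Real.logb 2 x)).1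
        have h0 : 0 ≤ (2 : ℝ) ^ Real.sin (2 * Real.pi * Real.logb 2 x) := by linarith
        unfold reebExample
        positivity
      · rw [reebExample, ← mul_assoc]
        rcases eq_or_ne x 0 with rfl | hx
        · simp
        · have hx' : (x : ℝ) ≠ 0 := by exact_mod_cast hx
          rw [show (x : ℝ) ^ 2 * (x : ℝ)⁻¹ = x by field_simp]
          exact mul_le_mul_of_nonneg_left (two_rpow_sin_mem _).2 x.2
    · have h0 : ContinuousAt reebExample x :=
        continuousOn_reebExample.continuousAt (Ioi_mem_nhds (by exact_mod_cast pos_iff_ne_zero.2 hx))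
      have h1 : ContinuousAt (fun x : ℝ≥0 => reebExample x) x :=
        ContinuousAt.comp (f := fun x : ℝ≥0 => (x : ℝ)) h0 NNReal.continuous_coe.continuousAt
      exact (by fun_prop : Continuous fun x : ℝ≥0 => (x : ℝ) ^ 2).continuousAt.mul h1
  have h2 : Continuous fun x : ℝ≥0 => (x : ℝ) * ((x : ℝ) * Real.log x) :=
    NNReal.continuous_coe.mul (Real.continuous_mul_log.comp NNReal.continuous_coe)
  refine (h1.add h2).congr fun x => ?_
  rw [Pi.add_apply]
  ring

/-! ### Leaves and orbits of the standard flow. -/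

namespace ReebPlane

theorem fst_pos_or_snd_pos (p : ReebPlane) : 0 < p.1.1 ∨ 0 < p.1.2 := by
  obtain ⟨⟨a, b⟩, ha, hb, hab⟩ := p
  rcases ha.lt_or_eq with h | h
  · exact Or.inl h
  · rcases hb.lt_or_eq with h' | h'
    · exact Or.inr h'
    · exact absurd (Prod.ext h.symm h'.symm) hab

/-- The parameter `ξ η` of the leaf through a point. -/
def leaf (p : ReebPlane) : ℝ≥0 := ⟨p.1.1 * p.1.2, mul_nonneg p.2.1 p.2.2.1⟩

theorem coe_leaf (p : ReebPlane) : (leaf p : ℝ) = p.1.1 * p.1.2 := rfl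

theorem continuous_leaf : Continuous leaf := by
  unfold leaf
  fun_prop

@[simp]
theorem standardReebFlow_fst (s : ℝ) (p : ReebPlane) :
    (standardReebFlow s p).1.1 = Real.exp s * p.1.1 := rfl

@[simp]
theorem standardReebFlow_snd (s : ℝ) (p : ReebPlane) :
    (standardReebFlow s p).1.2 = Real.exp (-s) * p.1.2 := rfl

@[simp]
theorem leaf_standardReebFlow (s : ℝ) (p : ReebPlane) : leaf (standardReebFlow s p) = leaf p := by
  apply NNReal.eq
  simp only [coe_leaf, standardReebFlow_fst, standardReebFlow_snd, Real.exp_neg]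
  field_simp

/-- The point `(x, 1)`. -/
def left (x : ℝ≥0) : ReebPlane := ⟨(x, 1), x.2, zero_le_one, by simp⟩

/-- The point `(1, x)`. -/
def right (x : ℝ≥0) : ReebPlane := ⟨(1, x), zero_le_one, x.2, by simp⟩

theorem continuous_left : Continuous left := by
  unfold left
  fun_prop

theorem continuous_right : Continuous right := by
  unfold right
  fun_prop

@[simp]
theorem leaf_left (x : ℝ≥0) : leaf (left x) = x := NNReal.eq (mul_one _)

@[simp]
theorem leaf_right (x : ℝ≥0) : leaf (right x) = x := NNReal.eq (one_mul _)

theorem standardReebFlow_left {p : ReebPlane} (hp : 0 < p.1.2) :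
    standardReebFlow (-Real.log p.1.2) (left (leaf p)) = p := by
  apply Subtype.ext
  ext
  · rw [standardReebFlow_fst, Real.exp_neg, Real.exp_log hp]
    change _ * (p.1.1 * p.1.2) = _
    field_simp
  · rw [standardReebFlow_snd, neg_neg, Real.exp_log hp]
    exact mul_one _

theorem standardReebFlow_right {p : ReebPlane} (hp : 0 < p.1.1) :
    standardReebFlow (Real.log p.1.1) (right (leaf p)) = p := by
  apply Subtype.ext
  ext
  · rw [standardReebFlow_fst, Real.exp_log hp]
    exact mul_one _
  · rw [standardReebFlow_snd, Real.exp_neg, Real.exp_log hp]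
    change _ * (p.1.1 * p.1.2) = _
    field_simp

theorem mem_inner_iff {p : ReebPlane} : p ∈ inner ↔ leaf p ≠ 0 := by
  rw [← NNReal.coe_ne_zero, coe_leaf, mul_ne_zero_iff]
  exact ⟨fun h => ⟨h.1.ne', h.2.ne'⟩, fun h => ⟨p.2.1.lt_of_ne' h.1, p.2.2.1.lt_of_ne' h.2⟩⟩

theorem leaf_eq_of_mem_orbit {p q : ReebPlane} (h : q ∈ standardReebFlow.orbit p) :
    leaf q = leaf p := by
  obtain ⟨s, rfl⟩ := (Flow.mem_orbit_iff _).1 h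
  exact leaf_standardReebFlow s p

theorem mem_orbit_of_leaf_eq {p q : ReebPlane} (hp : p ∈ inner) (h : leaf q = leaf p) :
    q ∈ standardReebFlow.orbit p := by
  have hq : q ∈ inner := by rwa [mem_inner_iff, h, ← mem_inner_iff]
  rw [Flow.mem_orbit_iff, ← standardReebFlow_left hp.2, ← standardReebFlow_left hq.2, h]
  exact ⟨-Real.log q.1.2 + Real.log p.1.2, by rw [← Flow.map_add]; simp⟩

/-! ### The delayed flow and its two time coordinates. -/

variable (K : C(ℝ≥0, ℝ≥0))

/-- The passage of time along the leaves: a cocycle over the standard Reeb flow that delays the leaf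
`ξ η = x` by the total amount `K x / x ^ 2`. -/
noncomputable def delay (p : ReebPlane) (s : ℝ) : ℝ :=
  s + K (leaf p) * (Real.exp (2 * s) - Real.exp (-(2 * s))) /
    ((Real.exp (2 * s) * p.1.1 ^ 2 + Real.exp (-(2 * s)) * p.1.2 ^ 2) *
      (p.1.1 ^ 2 + p.1.2 ^ 2))

/-- The time coordinate near the boundary leaf `{ξ = 0}`. -/
noncomputable def leftTime (p : ReebPlane) : ℝ :=
  -Real.log p.1.2 + K (leaf p) / (p.1.2 ^ 2 * (p.1.1 ^ 2 + p.1.2 ^ 2))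

/-- The time coordinate near the boundary leaf `{η = 0}`. -/
noncomputable def rightTime (p : ReebPlane) : ℝ :=
  Real.log p.1.1 - K (leaf p) / (p.1.1 ^ 2 * (p.1.1 ^ 2 + p.1.2 ^ 2))

theorem add_sq_pos (p : ReebPlane) {a b : ℝ} (ha : 0 < a) (hb : 0 < b) :
    0 < a * p.1.1 ^ 2 + b * p.1.2 ^ 2 := by
  rcases p.fst_pos_or_snd_pos with h | h <;> positivity

theorem sq_add_sq_pos (p : ReebPlane) : 0 < p.1.1 ^ 2 + p.1.2 ^ 2 := by
  simpa using p.add_sq_pos one_pos one_pos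

/-- As a coboundary, the delay is visibly additive. The formula for `delay` itself is kept because
it stays continuous on both boundary leaves. -/
theorem delay_eq_leftTime_sub {p : ReebPlane} (hp : 0 < p.1.2) (s : ℝ) :
    delay K p s = leftTime K (standardReebFlow s p) - leftTime K p := by
  have h1 := p.sq_add_sq_pos.ne'
  have h2 := (p.add_sq_pos (Real.exp_pos (2 * s)) (Real.exp_pos (-(2 * s)))).ne'
  have h3 : Real.exp (2 * s) = Real.exp s ^ 2 := by rw [← Real.exp_nat_mul]; norm_cast
  simp only [delay, leftTime, leaf_standardReebFlow, standardReebFlow_fst, standardReebFlow_snd]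
  rw [Real.log_mul (Real.exp_pos _).ne' hp.ne', Real.log_exp]
  simp only [Real.exp_neg, h3, mul_pow, inv_pow] at h2 ⊢
  have he := (Real.exp_pos s).ne'
  generalize Real.exp s = e at *
  -- This factor appears when the negative powers of `e` are cleared from the denominator of
  -- `delay`.
  have h4 : e ^ 4 * p.1.1 ^ 2 + p.1.2 ^ 2 ≠ 0 := by
    intro h
    apply h2
    field_simp
    linear_combination h
  field_simp
  ring

theorem delay_eq_rightTime_sub {p : ReebPlane} (hp : 0 < p.1.1) (s : ℝ) :
    delay K p s = rightTime K (standardReebFlow s p) - rightTime K p := by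
  have h1 := p.sq_add_sq_pos.ne'
  have h2 := (p.add_sq_pos (Real.exp_pos (2 * s)) (Real.exp_pos (-(2 * s)))).ne'
  have h3 : Real.exp (2 * s) = Real.exp s ^ 2 := by rw [← Real.exp_nat_mul]; norm_cast
  simp only [delay, rightTime, leaf_standardReebFlow, standardReebFlow_fst, standardReebFlow_snd]
  rw [Real.log_mul (Real.exp_pos _).ne' hp.ne', Real.log_exp]
  simp only [Real.exp_neg, h3, mul_pow, inv_pow] at h2 ⊢
  have he := (Real.exp_pos s).ne'
  generalize Real.exp s = e at *
  have h4 : e ^ 4 * p.1.1 ^ 2 + p.1.2 ^ 2 ≠ 0 := by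
    intro h
    apply h2
    field_simp
    linear_combination h
  field_simp
  ring

theorem isTimeCocycle_delay : IsTimeCocycle standardReebFlow (delay K) where
  continuous := by
    have hK : Continuous fun q : ReebPlane × ℝ => (K (leaf q.1) : ℝ) :=
      NNReal.continuous_coe.comp (K.continuous.comp (continuous_leaf.comp continuous_fst))
    unfold Function.uncurry delay
    refine continuous_snd.add (Continuous.div (hK.mul (by fun_prop)) (by fun_prop) fun q => ?_)
    exact (mul_pos (q.1.add_sq_pos (Real.exp_pos _) (Real.exp_pos _)) q.1.sq_add_sq_pos).ne'
  add p s t := by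
    rcases p.fst_pos_or_snd_pos with h | h
    · have h' : 0 < (standardReebFlow s p).1.1 := mul_pos (Real.exp_pos _) h
      rw [delay_eq_rightTime_sub K h, delay_eq_rightTime_sub K h, delay_eq_rightTime_sub K h',
        ← Flow.map_add, add_comm t s]
      ring
    · have h' : 0 < (standardReebFlow s p).1.2 := mul_pos (Real.exp_pos _) h
      rw [delay_eq_leftTime_sub K h, delay_eq_leftTime_sub K h, delay_eq_leftTime_sub K h',
        ← Flow.map_add, add_comm t s]
      ring
  le p s hs := by
    have h1 : 0 ≤ Real.exp (2 * s) - Real.exp (-(2 * s)) :=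
      sub_nonneg.2 (Real.exp_le_exp.2 (by linarith))
    have h2 := p.add_sq_pos (Real.exp_pos (2 * s)) (Real.exp_pos (-(2 * s)))
    have h3 := p.sq_add_sq_pos
    rw [delay, le_add_iff_nonneg_right]
    positivity

/-- The `ℛ`-flow with transit times `K x / x ^ 2 - log x`. -/
noncomputable def delayFlow : Flow ℝ ReebPlane := (isTimeCocycle_delay K).timeChange

theorem isReebFlow_delayFlow : IsReebFlow (delayFlow K) :=
  (isTimeCocycle_delay K).isReebFlow_timeChange

theorem delayFlow_eq (t : ℝ) (p : ReebPlane) :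
    ∃ s, delayFlow K t p = standardReebFlow s p ∧ delay K p s = t :=
  ⟨_, rfl, (isTimeCocycle_delay K).apply_inv p t⟩

@[simp]
theorem leaf_delayFlow (t : ℝ) (p : ReebPlane) : leaf (delayFlow K t p) = leaf p :=
  leaf_standardReebFlow _ p

@[simp]
theorem delayFlow_fst_pos {t : ℝ} {p : ReebPlane} :
    0 < (delayFlow K t p).1.1 ↔ 0 < p.1.1 := by
  obtain ⟨s, h, -⟩ := delayFlow_eq K t p
  simp [h, Real.exp_pos]

@[simp]
theorem delayFlow_snd_pos {t : ℝ} {p : ReebPlane} :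
    0 < (delayFlow K t p).1.2 ↔ 0 < p.1.2 := by
  obtain ⟨s, h, -⟩ := delayFlow_eq K t p
  simp [h, Real.exp_pos]

theorem leftTime_delayFlow {p : ReebPlane} (hp : 0 < p.1.2) (t : ℝ) :
    leftTime K (delayFlow K t p) = leftTime K p + t := by
  obtain ⟨s, h, hs⟩ := delayFlow_eq K t p
  rw [h, ← hs, delay_eq_leftTime_sub K hp]
  ring

theorem rightTime_delayFlow {p : ReebPlane} (hp : 0 < p.1.1) (t : ℝ) :
    rightTime K (delayFlow K t p) = rightTime K p + t := by
  obtain ⟨s, h, hs⟩ := delayFlow_eq K t p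
  rw [h, ← hs, delay_eq_rightTime_sub K hp]
  ring

/-- The two fractions add up because `1/ξ² + 1/η² = (ξ² + η²)/(ξη)²`, which cancels the common
factor `ξ² + η²`. -/
theorem leftTime_sub_rightTime {p : ReebPlane} (hp : p ∈ inner) :
    leftTime K p - rightTime K p = K (leaf p) / (leaf p : ℝ) ^ 2 - Real.log (leaf p) := by
  have h1 := hp.1
  have h2 := hp.2
  have h3 := p.sq_add_sq_pos.ne'
  rw [leftTime, rightTime, coe_leaf, Real.log_mul h1.ne' h2.ne']
  field_simp
  ring

theorem continuousOn_leftTime : ContinuousOn (leftTime K) {p | 0 < p.1.2} := by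
  have hK : Continuous fun p : ReebPlane => (K (leaf p) : ℝ) :=
    NNReal.continuous_coe.comp (K.continuous.comp continuous_leaf)
  unfold leftTime
  refine ContinuousOn.add (ContinuousOn.neg (ContinuousOn.log (by fun_prop) fun p hp => hp.ne'))
    (hK.continuousOn.div (by fun_prop) fun p hp => ?_)
  exact (mul_pos (pow_pos hp 2) p.sq_add_sq_pos).ne'

theorem continuousOn_rightTime : ContinuousOn (rightTime K) {p | 0 < p.1.1} := by
  have hK : Continuous fun p : ReebPlane => (K (leaf p) : ℝ) :=
    NNReal.continuous_coe.comp (K.continuous.comp continuous_leaf)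
  unfold rightTime
  refine ContinuousOn.sub (ContinuousOn.log (by fun_prop) fun p hp => hp.ne')
    (hK.continuousOn.div (by fun_prop) fun p hp => ?_)
  exact (mul_pos (pow_pos hp 2) p.sq_add_sq_pos).ne'

/-! ### Transversals and transit times. -/

/-- The transversal `leftTime = 0`, parametrized by leaves. -/
noncomputable def leftCurve (x : ℝ≥0) : ReebPlane := delayFlow K (-leftTime K (left x)) (left x)

/-- The transversal `rightTime = 0`, parametrized by leaves. -/
noncomputable def rightCurve (x : ℝ≥0) : ReebPlane := delayFlow K (-rightTime K (right x)) (right x)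

@[simp]
theorem leaf_leftCurve (x : ℝ≥0) : leaf (leftCurve K x) = x := by simp [leftCurve]

@[simp]
theorem leaf_rightCurve (x : ℝ≥0) : leaf (rightCurve K x) = x := by simp [rightCurve]

@[simp]
theorem leftCurve_snd_pos (x : ℝ≥0) : 0 < (leftCurve K x).1.2 := by
  rw [leftCurve, delayFlow_snd_pos]
  exact one_pos

@[simp]
theorem rightCurve_fst_pos (x : ℝ≥0) : 0 < (rightCurve K x).1.1 := by
  rw [rightCurve, delayFlow_fst_pos]
  exact one_pos

@[simp]
theorem leftTime_leftCurve (x : ℝ≥0) : leftTime K (leftCurve K x) = 0 := by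
  rw [leftCurve, leftTime_delayFlow K (p := left x) one_pos, add_neg_cancel]

@[simp]
theorem rightTime_rightCurve (x : ℝ≥0) : rightTime K (rightCurve K x) = 0 := by
  rw [rightCurve, rightTime_delayFlow K (p := right x) one_pos, add_neg_cancel]

theorem continuous_leftCurve : Continuous (leftCurve K) := by
  refine (delayFlow K).continuous (Continuous.neg ?_) continuous_left
  exact (continuousOn_leftTime K).comp_continuous continuous_left fun x => one_pos (α := ℝ)

theorem continuous_rightCurve : Continuous (rightCurve K) := by
  refine (delayFlow K).continuous (Continuous.neg ?_) continuous_right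
  exact (continuousOn_rightTime K).comp_continuous continuous_right fun x => one_pos (α := ℝ)

/-- Leaf and `leftTime` thus form a coordinate system on `{η > 0}`, in which the flow is a
translation. -/
theorem delayFlow_leftCurve {p : ReebPlane} (hp : 0 < p.1.2) :
    delayFlow K (leftTime K p) (leftCurve K (leaf p)) = p := by
  have h1 : delayFlow K (leftTime K p - leftTime K (left (leaf p))) (left (leaf p)) = p := by
    have h2 := (isTimeCocycle_delay K).timeChange_apply (left (leaf p)) (-Real.log p.1.2)
    rwa [standardReebFlow_left hp, delay_eq_leftTime_sub K (p := left (leaf p)) one_pos,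
      standardReebFlow_left hp] at h2
  rw [leftCurve, ← Flow.map_add, ← sub_eq_add_neg, h1]

theorem delayFlow_rightCurve {p : ReebPlane} (hp : 0 < p.1.1) :
    delayFlow K (rightTime K p) (rightCurve K (leaf p)) = p := by
  have h1 : delayFlow K (rightTime K p - rightTime K (right (leaf p))) (right (leaf p)) = p := by
    have h2 := (isTimeCocycle_delay K).timeChange_apply (right (leaf p)) (Real.log p.1.1)
    rwa [standardReebFlow_right hp, delay_eq_rightTime_sub K (p := right (leaf p)) one_pos,
      standardReebFlow_right hp] at h2
  rw [rightCurve, ← Flow.map_add, ← sub_eq_add_neg, h1]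

theorem isReebTransversal_of_leaf_eq {B : Set ReebPlane} {γ : ℝ≥0 → ReebPlane} (hγ : Continuous γ)
    (hleaf : ∀ x, leaf (γ x) = x) (h0 : γ 0 ∈ B) : IsReebTransversal B γ where
  continuous := hγ
  start := h0
  mem_inner x hx := by rw [mem_inner_iff, hleaf]; exact hx.ne'
  meets p hp := by
    refine ⟨leaf p, mem_orbit_of_leaf_eq hp (hleaf _), fun x hx => ?_⟩
    rw [← leaf_eq_of_mem_orbit hx, hleaf]

theorem isReebTransversal_leftCurve : IsReebTransversal xiZero (leftCurve K) := by
  refine isReebTransversal_of_leaf_eq (continuous_leftCurve K) (leaf_leftCurve K) ?_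
  have h : ((leaf (leftCurve K 0) : ℝ≥0) : ℝ) = 0 := by simp
  exact (mul_eq_zero.1 h).resolve_right (leftCurve_snd_pos K 0).ne'

theorem isReebTransversal_rightCurve : IsReebTransversal etaZero (rightCurve K) := by
  refine isReebTransversal_of_leaf_eq (continuous_rightCurve K) (leaf_rightCurve K) ?_
  have h : ((leaf (rightCurve K 0) : ℝ≥0) : ℝ) = 0 := by simp
  exact (mul_eq_zero.1 h).resolve_left (rightCurve_fst_pos K 0).ne'

theorem leftCurve_mem_inner {x : ℝ≥0} (hx : x ≠ 0) : leftCurve K x ∈ inner := by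
  rwa [mem_inner_iff, leaf_leftCurve]

theorem delayFlow_leftCurve_eq_rightCurve {x : ℝ≥0} (hx : x ≠ 0) :
    delayFlow K (K x / (x : ℝ) ^ 2 - Real.log x) (leftCurve K x) = rightCurve K x := by
  have h1 := leftCurve_mem_inner K hx
  have h2 := leftTime_sub_rightTime K h1
  rw [leaf_leftCurve, leftTime_leftCurve, zero_sub] at h2
  have h3 := delayFlow_rightCurve K h1.1
  rw [leaf_leftCurve] at h3
  rw [← h2, ← h3, ← Flow.map_add, h3, neg_add_cancel, Flow.map_zero_apply]

theorem delayFlow_injective {p : ReebPlane} : Function.Injective fun t => delayFlow K t p := by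
  intro t t' h
  dsimp only at h
  rcases p.fst_pos_or_snd_pos with hp | hp
  · have := congrArg (rightTime K) h
    simpa [rightTime_delayFlow K hp] using this
  · have := congrArg (leftTime K) h
    simpa [leftTime_delayFlow K hp] using this

theorem isTransitTime_delayFlow {f : ℝ → ℝ}
    (hf : ∀ x : ℝ≥0, x ≠ 0 → K x / (x : ℝ) ^ 2 - Real.log x = f x) :
    IsTransitTime (delayFlow K) (leftCurve K) (rightCurve K) f := by
  intro x hx t
  have h := delayFlow_leftCurve_eq_rightCurve K hx.ne'
  rw [hf x hx.ne'] at h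
  constructor
  · rintro ⟨y, hy⟩
    have hxy : y = x := by
      have := congrArg leaf hy
      simpa using this
    rw [hxy, ← h] at hy
    exact (delayFlow_injective K hy).symm
  · rintro rfl
    exact ⟨x, h.symm⟩

end ReebPlane

/-! ### The conjugacy that rescales time. -/

namespace ReebPlane

variable (K : C(ℝ≥0, ℝ≥0))

/-- The time from `leftCurve K x` to `rightCurve K x`. -/
noncomputable def transitTime (x : ℝ≥0) : ℝ := K x / (x : ℝ) ^ 2 - Real.log x

/-- The map that multiplies the leaf parameter by `l` and divides the time coordinates by `l`. -/
noncomputable def scaleMap (l : ℝ≥0) (p : ReebPlane) : ReebPlane :=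
  open Classical in
  if 0 < p.1.2 then delayFlow K (leftTime K p / l) (leftCurve K (l * leaf p))
  else delayFlow K (rightTime K p / l) (rightCurve K (l * leaf p))

variable {K} {l : ℝ≥0}

theorem scaleMap_of_snd_pos {p : ReebPlane} (hp : 0 < p.1.2) :
    scaleMap K l p = delayFlow K (leftTime K p / l) (leftCurve K (l * leaf p)) := if_pos hp

/-- On interior leaves the left and right formulas differ by a transit time, and the functional
equation makes them agree. Continuity at `{η = 0}` depends on this. -/
theorem scaleMap_of_fst_pos (hl : l ≠ 0)
    (h : ∀ x, x ≠ 0 → transitTime K (l * x) = transitTime K x / l)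
    {p : ReebPlane} (hp : 0 < p.1.1) :
    scaleMap K l p = delayFlow K (rightTime K p / l) (rightCurve K (l * leaf p)) := by
  by_cases hp2 : 0 < p.1.2
  · have hx : leaf p ≠ 0 := mem_inner_iff.1 ⟨hp, hp2⟩
    rw [scaleMap_of_snd_pos hp2, ← delayFlow_leftCurve_eq_rightCurve K (mul_ne_zero hl hx),
      ← Flow.map_add]
    congr 1
    have h1 := leftTime_sub_rightTime K (p := p) ⟨hp, hp2⟩
    have h2 := h _ hx
    unfold transitTime at h2
    rw [h2, ← h1]
    ring
  · exact if_neg hp2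

theorem continuous_scaleMap (hl : l ≠ 0)
    (h : ∀ x, x ≠ 0 → transitTime K (l * x) = transitTime K x / l) :
    Continuous (scaleMap K l) := by
  have hleaf : Continuous fun p : ReebPlane => l * leaf p := continuous_const.mul continuous_leaf
  have hflow : Continuous fun q : ℝ × ReebPlane => delayFlow K q.1 q.2 := (delayFlow K).cont'
  have h1 : ContinuousOn (scaleMap K l) {p | 0 < p.1.2} := by
    refine ContinuousOn.congr (hflow.comp_continuousOn (ContinuousOn.prodMk
      ((continuousOn_leftTime K).div_const (l : ℝ))
      ((continuous_leftCurve K).comp hleaf).continuousOn)) fun p hp => ?_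
    exact scaleMap_of_snd_pos hp
  have h2 : ContinuousOn (scaleMap K l) {p | 0 < p.1.1} := by
    refine ContinuousOn.congr (hflow.comp_continuousOn (ContinuousOn.prodMk
      ((continuousOn_rightTime K).div_const (l : ℝ))
      ((continuous_rightCurve K).comp hleaf).continuousOn)) fun p hp => ?_
    exact scaleMap_of_fst_pos hl h hp
  rw [continuous_iff_continuousAt]
  intro p
  rcases p.fst_pos_or_snd_pos with hp | hp
  · exact h2.continuousAt ((isOpen_lt continuous_const (by fun_prop)).mem_nhds hp)
  · exact h1.continuousAt ((isOpen_lt continuous_const (by fun_prop)).mem_nhds hp)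

theorem scaleMap_delayFlow (hl : l ≠ 0)
    (h : ∀ x, x ≠ 0 → transitTime K (l * x) = transitTime K x / l) (t : ℝ) (p : ReebPlane) :
    scaleMap K l (delayFlow K (l * t) p) = delayFlow K t (scaleMap K l p) := by
  have hl' : (l : ℝ) ≠ 0 := by exact_mod_cast hl
  rcases p.fst_pos_or_snd_pos with hp | hp
  · rw [scaleMap_of_fst_pos hl h hp, scaleMap_of_fst_pos hl h ((delayFlow_fst_pos K).2 hp),
      ← Flow.map_add, leaf_delayFlow, rightTime_delayFlow K hp]
    congr 1
    field_simp
    ring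
  · rw [scaleMap_of_snd_pos hp, scaleMap_of_snd_pos ((delayFlow_snd_pos K).2 hp),
      ← Flow.map_add, leaf_delayFlow, leftTime_delayFlow K hp]
    congr 1
    field_simp
    ring

theorem scaleMap_scaleMap {m : ℝ≥0} (hml : m * l = 1)
    (h : ∀ x, x ≠ 0 → transitTime K (l * x) = transitTime K x / l)
    (h' : ∀ x, x ≠ 0 → transitTime K (m * x) = transitTime K x / m) (p : ReebPlane) :
    scaleMap K m (scaleMap K l p) = p := by
  have hl : l ≠ 0 := right_ne_zero_of_mul_eq_one hml
  have hm : m ≠ 0 := left_ne_zero_of_mul_eq_one hml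
  have hlm : (l : ℝ) * m = 1 := by rw [mul_comm]; exact_mod_cast hml
  rcases p.fst_pos_or_snd_pos with hp | hp
  · rw [scaleMap_of_fst_pos hl h hp, scaleMap_of_fst_pos hm h' (by simp), leaf_delayFlow,
      leaf_rightCurve, rightTime_delayFlow K (by simp), rightTime_rightCurve, zero_add, div_div,
      hlm, div_one, ← mul_assoc, hml, one_mul, delayFlow_rightCurve K hp]
  · rw [scaleMap_of_snd_pos hp, scaleMap_of_snd_pos (by simp), leaf_delayFlow,
      leaf_leftCurve, leftTime_delayFlow K (by simp), leftTime_leftCurve, zero_add, div_div,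
      hlm, div_one, ← mul_assoc, hml, one_mul, delayFlow_leftCurve K hp]

theorem isConjugate_rescale_delayFlow (hl : l ≠ 0)
    (h : ∀ x, x ≠ 0 → transitTime K (l * x) = transitTime K x / l) :
    ((delayFlow K).rescale l).IsConjugate (delayFlow K) := by
  have h' (x : ℝ≥0) (hx : x ≠ 0) : transitTime K (l⁻¹ * x) = transitTime K x / (l⁻¹ : ℝ≥0) := by
    have hl' : (l : ℝ) ≠ 0 := by exact_mod_cast hl
    have h1 := h (l⁻¹ * x) (mul_ne_zero (inv_ne_zero hl) hx)
    rw [mul_inv_cancel_left₀ hl] at h1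
    rw [h1, NNReal.coe_inv]
    field_simp
  let e : ReebPlane ≃ₜ ReebPlane :=
    { toFun := scaleMap K l
      invFun := scaleMap K l⁻¹
      left_inv := scaleMap_scaleMap (inv_mul_cancel₀ hl) h h'
      right_inv := scaleMap_scaleMap (mul_inv_cancel₀ hl) h' h
      continuous_toFun := continuous_scaleMap hl h
      continuous_invFun := continuous_scaleMap (inv_ne_zero hl) h' }
  exact ⟨e, e.continuous, e.surjective, fun t p => scaleMap_delayFlow hl h t p⟩

/-! ### The obstruction to conjugacy with the standard flow. -/

/-- A flow with transit times tending to infinity is not conjugate to the standard Reeb flow if the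
transit times oscillate by large amounts near the boundary leaves. -/
theorem not_isConjugate_standardReebFlow {φ : Flow ℝ ReebPlane} {γ₁ γ₂ : ℝ≥0 → ReebPlane}
    {f : ℝ≥0 → ℝ} (h₁ : Continuous γ₁) (h₂ : Continuous γ₂)
    (hinj : ∀ x y t, φ t (γ₁ x) = γ₁ y → x = y)
    (htrans : ∀ x, 0 < x → φ (f x) (γ₁ x) = γ₂ x)
    (hlim : Tendsto f (𝓝[>] 0) atTop)
    (hosc : ∀ C : ℝ, ∀ δ : ℝ≥0, 0 < δ → ∃ x y, 0 < x ∧ x < y ∧ y < δ ∧ f x + C < f y) :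
    ¬ φ.IsConjugate standardReebFlow := by
  rintro ⟨h, hh⟩
  set u : ℝ≥0 → ReebPlane := fun x => h (γ₁ x) with hu
  set v : ℝ≥0 → ReebPlane := fun x => h (γ₂ x) with hv
  have hcu : Continuous u := h.continuous.comp h₁
  have hcv : Continuous v := h.continuous.comp h₂
  have huv (x : ℝ≥0) (hx : 0 < x) : standardReebFlow (f x) (u x) = v x := by
    rw [hv, ← (hh.semiconj (f x)).eq, htrans x hx]
  have hu1 (x : ℝ≥0) (hx : 0 < x) : (u x).1.1 = Real.exp (-f x) * (v x).1.1 := by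
    rw [← huv x hx, standardReebFlow_fst, Real.exp_neg, inv_mul_cancel_left₀ (Real.exp_ne_zero _)]
  have hv2 (x : ℝ≥0) (hx : 0 < x) : (v x).1.2 = Real.exp (-f x) * (u x).1.2 := by
    rw [← huv x hx, standardReebFlow_snd]
  have hexp : Tendsto (fun x => Real.exp (-f x)) (𝓝[>] 0) (𝓝 0) :=
    Real.tendsto_exp_neg_atTop_nhds_zero.comp hlim
  have cu1 : Continuous fun x => (u x).1.1 := by fun_prop
  have cu2 : Continuous fun x => (u x).1.2 := by fun_prop
  have cv1 : Continuous fun x => (v x).1.1 := by fun_prop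
  have cv2 : Continuous fun x => (v x).1.2 := by fun_prop
  -- Here `u₁ = e^{-f} v₁` with `v₁` convergent, so infinite transit time forces `u 0` onto `{ξ =
  -- 0}`; likewise `v 0` lies on `{η = 0}`.
  have hu0 : (u 0).1.1 = 0 := by
    refine tendsto_nhds_unique (cu1.continuousAt.tendsto.mono_left nhdsWithin_le_nhds) ?_
      (l := 𝓝[>] (0 : ℝ≥0))
    have := hexp.mul (cv1.continuousAt.tendsto.mono_left (nhdsWithin_le_nhds (s := Ioi (0 : ℝ≥0))))
    rw [zero_mul] at this
    refine this.congr' ?_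
    filter_upwards [self_mem_nhdsWithin] with x hx using (hu1 x hx).symm
  have hv0 : (v 0).1.2 = 0 := by
    refine tendsto_nhds_unique (cv2.continuousAt.tendsto.mono_left nhdsWithin_le_nhds) ?_
      (l := 𝓝[>] (0 : ℝ≥0))
    have := hexp.mul (cu2.continuousAt.tendsto.mono_left (nhdsWithin_le_nhds (s := Ioi (0 : ℝ≥0))))
    rw [zero_mul] at this
    refine this.congr' ?_
    filter_upwards [self_mem_nhdsWithin] with x hx using (hv2 x hx).symm
  have hu0' : 0 < (u 0).1.2 := (u 0).fst_pos_or_snd_pos.resolve_left (by rw [hu0]; exact lt_irrefl _)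
  have hv0' : 0 < (v 0).1.1 := (v 0).fst_pos_or_snd_pos.resolve_right (by rw [hv0]; exact lt_irrefl _)
  have hg : ContinuousAt (fun x => Real.log (u x).1.2 + Real.log (v x).1.1) 0 :=
    (cu2.continuousAt.log hu0'.ne').add (cv1.continuousAt.log hv0'.ne')
  obtain ⟨δ, hδ, H⟩ := NNReal.nhds_zero_basis.eventually_iff.1
    (((cu2.continuousAt.eventually_const_lt hu0').and (cv1.continuousAt.eventually_const_lt hv0')).and
      (hg.eventually (Metric.ball_mem_nhds _ one_pos)))
  have hleaf (x : ℝ≥0) (hx : 0 < x) (hxδ : x < δ) : 0 < (leaf (u x) : ℝ) ∧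
      Real.log (leaf (u x)) = Real.log (u x).1.2 + Real.log (v x).1.1 - f x := by
    obtain ⟨⟨h1, h2⟩, -⟩ := H hxδ
    have h3 := Real.exp_pos (-f x)
    rw [coe_leaf, hu1 x hx]
    refine ⟨by positivity, ?_⟩
    rw [Real.log_mul (by positivity) h1.ne', Real.log_mul h3.ne' h2.ne', Real.log_exp]
    ring
  -- Below `δ` the continuous part of `log leaf(u)` stays within 1 of its value at 0, so it varies
  -- by less than 2. A rise of `f` by more than 2 thus puts `u y` on a lower leaf than `u x`.
  obtain ⟨x, y, hx, hxy, hy, hlt⟩ := hosc 2 δ hδ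
  obtain ⟨hxp, hxl⟩ := hleaf x hx (hxy.trans hy)
  obtain ⟨hyp, hyl⟩ := hleaf y (hx.trans hxy) hy
  have hxb := abs_lt.1 ((Real.dist_eq _ _).symm.trans_lt (H (hxy.trans hy)).2)
  have hyb := abs_lt.1 ((Real.dist_eq _ _).symm.trans_lt (H hy).2)
  have hyx : leaf (u y) < leaf (u x) := by
    rw [← NNReal.coe_lt_coe, ← Real.log_lt_log_iff hyp hxp]
    linarith [hxb.1, hyb.2]
  have hl0 : leaf (u 0) = 0 := NNReal.eq (by rw [coe_leaf, hu0, zero_mul, NNReal.coe_zero])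
  -- The leaf of `u y` is already met at some `z ≤ x < y`, although `u` meets each orbit at most
  -- once.
  obtain ⟨z, hz, hzy⟩ := intermediate_value_Icc (zero_le (a := x))
    (continuous_leaf.comp hcu).continuousOn (show leaf (u y) ∈ Icc (leaf (u 0)) (leaf (u x)) from
      ⟨by rw [hl0]; exact zero_le, hyx.le⟩)
  obtain ⟨s, hs⟩ := (Flow.mem_orbit_iff _).1
    (mem_orbit_of_leaf_eq (mem_inner_iff.2 (NNReal.coe_ne_zero.1 hyp.ne')) hzy)
  have : y = z := by
    refine hinj y z s (h.injective ?_)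
    rw [(hh.semiconj s).eq]
    exact hs
  exact absurd hz.2 (by rw [← this]; exact hxy.not_ge)

end ReebPlane

/-! ### The flow with transit times `reebExample`. -/

/-- The total delay, multiplied by `x ^ 2`, that produces the transit times `reebExample`. -/
noncomputable def reebExampleDelay : C(ℝ≥0, ℝ≥0) where
  toFun x := Real.toNNReal ((x : ℝ) ^ 2 * (reebExample x + Real.log x))
  continuous_toFun := continuous_real_toNNReal.comp continuous_sq_mul_reebExample_add_log

theorem transitTime_reebExampleDelay {x : ℝ≥0} (hx : x ≠ 0) :
    ReebPlane.transitTime reebExampleDelay x = reebExample x := by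
  have hx' : (0 : ℝ) < x := NNReal.coe_pos.2 (pos_iff_ne_zero.2 hx)
  change ((Real.toNNReal ((x : ℝ) ^ 2 * (reebExample x + Real.log x)) : ℝ≥0) : ℝ) / (x : ℝ) ^ 2 -
    Real.log x = _
  rw [Real.coe_toNNReal _ (mul_nonneg (sq_nonneg _) (reebExample_add_log_nonneg hx'))]
  field_simp
  ring

theorem mainTheorem3 :
    reebExample ∈ reebE ∧
    (∀ x : ℝ, 0 < x → reebExample (x / 2) = 2 * reebExample x) ∧
    reebSigma reebExample = ⊤ ∧
    ∃ φ : Flow ℝ ReebPlane,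
      IsReebFlow φ ∧
      (∃ γ₁ γ₂ : ℝ≥0 → ReebPlane,
        IsReebTransversal ReebPlane.xiZero γ₁ ∧
        IsReebTransversal ReebPlane.etaZero γ₂ ∧
        IsTransitTime φ γ₁ γ₂ reebExample) ∧
      ¬ φ.IsConjugate standardReebFlow ∧
      (φ.rescale 2).IsConjugate φ := by
  refine ⟨reebExample_mem_reebE, fun x hx => reebExample_half hx, reebSigma_reebExample,
    ReebPlane.delayFlow reebExampleDelay, ReebPlane.isReebFlow_delayFlow _,
    ⟨ReebPlane.leftCurve _, ReebPlane.rightCurve _, ReebPlane.isReebTransversal_leftCurve _,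
      ReebPlane.isReebTransversal_rightCurve _,
      ReebPlane.isTransitTime_delayFlow _ fun x hx => transitTime_reebExampleDelay hx⟩, ?_, ?_⟩
  · refine ReebPlane.not_isConjugate_standardReebFlow (f := fun x => reebExample x)
      (ReebPlane.continuous_leftCurve reebExampleDelay)
      (ReebPlane.continuous_rightCurve reebExampleDelay) (fun x y t h => ?_) (fun x hx => ?_) ?_
      fun C δ hδ => ?_
    · have := congrArg ReebPlane.leaf h
      simpa using this
    · have h := ReebPlane.delayFlow_leftCurve_eq_rightCurve reebExampleDelay hx.ne'
      have h' := transitTime_reebExampleDelay hx.ne'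
      rw [ReebPlane.transitTime] at h'
      rwa [h'] at h
    · refine reebExample_mem_reebE.2.comp (tendsto_nhdsWithin_iff.2 ⟨?_, ?_⟩)
      · exact (NNReal.continuous_coe.tendsto' 0 0 rfl).mono_left nhdsWithin_le_nhds
      · filter_upwards [self_mem_nhdsWithin] with x hx using NNReal.coe_pos.2 hx
    · obtain ⟨x, y, hx, hxy, hy, h⟩ := exists_reebExample_add_lt C (NNReal.coe_pos.2 hδ)
      exact ⟨⟨x, hx.le⟩, ⟨y, (hx.trans hxy).le⟩, hx, hxy, hy, h⟩
  · refine ReebPlane.isConjugate_rescale_delayFlow (l := 2) two_ne_zero fun x hx => ?_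
    rw [transitTime_reebExampleDelay hx, transitTime_reebExampleDelay (mul_ne_zero two_ne_zero hx)]
    -- The halving law, used at `2x`, gives the functional equation `f(2x) = f(x)/2`.
    have h := reebExample_half (x := ((2 * x : ℝ≥0) : ℝ))
      (NNReal.coe_pos.2 (pos_iff_ne_zero.2 (mul_ne_zero two_ne_zero hx)))
    rw [show ((2 * x : ℝ≥0) : ℝ) / 2 = x by push_cast; ring] at h
    rw [h, NNReal.coe_ofNat]
    ring
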